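/- Let $\mathcal{D}\subseteq\mathbb{R}_{\ge 0}$ be a finite set with $0\in\mathcal{D}$, and let $\mathrm{M}=(M;\mathrm{d})$ be a countable Urysohn metric space with distance set $\mathcal{D}$; that is, $\mathrm{M}$ is a countable metric space whose set of distances is $\mathcal{D}$, every isometry of a finite subspace of $\mathrm{M}$ into $\mathrm{M}$ extends to an isometry of $\mathrm{M}$ onto $\mathrm{M}$, and every finite metric space with distances in $\mathcal{D}$ embeds isometrically into $\mathrm{M}$. For $r>0$ let $r^{\langle-\rangle}=\max([0,r)\cap\mathcal{D})$; for $r\in\mathcal D$ let $r^{\langle+\rangle}=\min\{s\in\mathcal{D}: s>r\}$ if $r<\max\mathcal{D}$ and $r^{\langle+\rangle}=r$ if $r=\max\mathcal{D}$. A set $\mathcal{B}=\{b_0<b_1<\dots<b_n\}\subseteq\mathcal{D}\setminus\{0\}$ is a block of $\mathcal{D}$ if $b_0>2\,b_0^{\langle-\rangle}$ and, for all $i<n$, $b_{i+1}=b_i^{\langle+\rangle}$ and $b_i+b_0\ge b_{i+1}$. The first block of $\mathcal{D}$ is the inclusion-maximal block $\mathcal{B}$ with $\min\mathcal{B}=\min(\mathcal{D}\setminus\{0\})$.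 A Katětov function of $\mathrm{M}$ is a function $\mathfrak{p}:F\to\mathcal{D}\setminus\{0\}$ with $F=\operatorname{dom}(\mathfrak{p})$ a finite subset of $M$, such that adding to $F$ one new point at distance $\mathfrak{p}(x)$ from each $x\in F$ gives a metric space. If $F\neq\emptyset$, its rank is $\operatorname{rank}(\mathfrak{p})=\min\{\mathfrak{p}(x):x\in F\}$. For $H\subseteq M$ put $\operatorname{orb}_H(\mathfrak{p})=\{y\in H\setminus F:\mathrm{d}(y,x)=\mathfrak{p}(x)\text{ for all }x\in F\}$. A copy of $\mathrm{M}$ in $\mathrm{M}$ is the image of an isometric embedding of $\mathrm{M}$ into $\mathrm{M}$. Let $\mathcal{B}$ be the first block of $\mathcal{D}$, let $r\in\mathcal{B}$ with $r>\min\mathcal{B}$, and let $S\subseteq M$. A Katětov function $\mathfrak{p}$ of $\mathrm{M}$ with $\operatorname{rank}(\mathfrak{p})=r$ is extendible into $S$ if for every copy $H$ of $\mathrm{M}$ in $\mathrm{M}$ with $\operatorname{dom}(\mathfrak{p})\subseteq H$ and every Katětov function $\mathfrak{p}'\supseteq\mathfrak{p}$ with $\operatorname{dom}(\mathfrak{p}')\subseteq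 H$ and $\operatorname{rank}(\mathfrak{p}')=r$ there are an isometric embedding $\alpha:H\to H$ with $\alpha(x)=x$ for all $x\in\operatorname{dom}(\mathfrak{p}')$ and a Katětov function $\mathfrak{g}\supseteq\mathfrak{p}'$ with $\operatorname{dom}(\mathfrak{g})\subseteq\alpha(H)$, $\operatorname{rank}(\mathfrak{g})=r^{\langle-\rangle}$ and $\operatorname{orb}_{\alpha(H)}(\mathfrak{g})\subseteq S$. Theorem. Let $\mathfrak{q}$ be a Katětov function of $\mathrm{M}$ with $\operatorname{rank}(\mathfrak{q})=r$ which is extendible into $S$. Then there is a copy $C$ of $\mathrm{M}$ in $\mathrm{M}$ with $\operatorname{dom}(\mathfrak{q})\subseteq C$ and $\operatorname{orb}_{C}(\mathfrak{q})\subseteq S$. -/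

import Mathlib

namespace UrysohnExt

/-- The metric space `M` is a countable Urysohn metric space with distance set exactly `D`:
it is homogeneous and every finite metric space with distances in `D` embeds into it. -/
structure IsCountableUrysohn (D : Set ℝ) (M : Type*) [MetricSpace M] : Prop where
  countable : Countable M
  dist_range : Set.range (fun p : M × M => dist p.1 p.2) = D
  homogeneous : ∀ (A : Finset M) (f : A → M), Isometry f →
    ∃ g : M ≃ᵢ M, ∀ a : A, g a = f a
  universal : ∀ (X : Type) [MetricSpace X] [Finite X], (∀ x y : X, dist x y ∈ D) →
    ∃ f : X → M, Isometry f

/-- `r^{⟨-⟩}`, the largest element of `D` below `r` (for `D` finite, `0 ∈ D` and `0 < r`). -/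
noncomputable def below (D : Set ℝ) (r : ℝ) : ℝ := sSup (Set.Ico 0 r ∩ D)

open Classical in
/-- `r^{⟨+⟩}`, the smallest element of `D` above `r` if `r < max D`, and `r` otherwise
(for `D` finite and nonempty). -/
noncomputable def above (D : Set ℝ) (r : ℝ) : ℝ :=
  if r < sSup D then sInf (Set.Ioc r (sSup D) ∩ D) else r

/-- `B` is a block of `D`: it has an increasing enumeration `b 0 < ⋯ < b n` by positive
consecutive elements of `D`, with gaps at most `b 0`, starting after a jump of `D`. -/
def IsBlock (D B : Set ℝ) : Prop :=
  B ⊆ D ∧ ∃ (n : ℕ) (b : Fin (n + 1) → ℝ), Set.range b = B ∧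
    0 < b 0 ∧
    (∀ i : Fin n, b i.castSucc < b i.succ) ∧
    below D (b 0) + below D (b 0) < b 0 ∧
    (∀ i : Fin n, b i.succ = above D (b i.castSucc)) ∧
    (∀ i : Fin n, b i.succ ≤ b i.castSucc + b 0)

/-- The first block of `D`: the (inclusion-maximal) block whose minimum is `min (D \ {0})`. -/
def IsFirstBlock (D B : Set ℝ) : Prop :=
  Maximal (fun B' : Set ℝ => IsBlock D B' ∧ ∃ m, IsLeast B' m ∧ IsLeast (D \ {0}) m) B

/-- A real-valued function on a finite subset `dom` of `M`. Only the values on `dom` matter: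
every notion below depends on `val` through its restriction to `dom` only. -/
structure TypeFn (M : Type*) where
  dom : Finset M
  val : M → ℝ

namespace TypeFn

variable {M : Type*}

/-- Inclusion `p ⊆ q` of partial functions. -/
def Sub (p q : TypeFn M) : Prop :=
  p.dom ⊆ q.dom ∧ ∀ x ∈ p.dom, q.val x = p.val x

/-- `rank p = r`: the minimum of the values of `p` is `r` (so the domain is nonempty). -/
def HasRank (p : TypeFn M) (r : ℝ) : Prop :=
  IsLeast (p.val '' (p.dom : Set M)) r

/-- The distance function of `Sp(p)`, on the domain of `p` together with the new point `none`
that represents `p` itself. -/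
def spDist [MetricSpace M] (p : TypeFn M) : Option p.dom → Option p.dom → ℝ
  | none, none => 0
  | none, some x => p.val x
  | some x, none => p.val x
  | some x, some y => dist (x : M) (y : M)

/-- `p` is a Katětov function (with respect to `D`): `Sp(p)` is a metric space with distances
in `D`. Since the new point differs from the points of the domain, the values are nonzero. -/
def IsKatetov [MetricSpace M] (D : Set ℝ) (p : TypeFn M) : Prop :=
  (∀ a b, p.spDist a b ∈ D) ∧
  (∀ a b, p.spDist a b = 0 ↔ a = b) ∧
  (∀ a b, p.spDist a b = p.spDist b a) ∧
  (∀ a b c, p.spDist a c ≤ p.spDist a b + p.spDist b c)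

/-- The orbit of `p` in the subspace `H`. -/
def orb [MetricSpace M] (H : Set M) (p : TypeFn M) : Set M :=
  {y | y ∈ H ∧ y ∉ p.dom ∧ ∀ x ∈ p.dom, dist y x = p.val x}

end TypeFn

/-- `C` is (the underlying set of) a copy of `M` in `M`. -/
def IsCopy {M : Type*} [MetricSpace M] (C : Set M) : Prop :=
  ∃ f : M → M, Isometry f ∧ Set.range f = C

/-- The Katětov function `p` of rank `r` is extendible into `S`. -/
def ExtendibleInto {M : Type*} [MetricSpace M] (D : Set ℝ) (r : ℝ) (S : Set M)
    (p : TypeFn M) : Prop :=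
  p.IsKatetov D ∧ p.HasRank r ∧
  ∀ H : Set M, IsCopy H → (p.dom : Set M) ⊆ H →
    ∀ p' : TypeFn M, p'.IsKatetov D → (p'.dom : Set M) ⊆ H → p.Sub p' → p'.HasRank r →
      ∃ α : H → H, Isometry α ∧ (∀ x : H, (x : M) ∈ p'.dom → α x = x) ∧
        ∃ g : TypeFn M, g.IsKatetov D ∧
          (g.dom : Set M) ⊆ Set.range (fun x : H => (α x : M)) ∧
          p'.Sub g ∧ g.HasRank (below D r) ∧
          g.orb (Set.range (fun x : H => (α x : M))) ⊆ S

end UrysohnExt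

/-! The copy is the range of the pointwise limit of isometric embeddings `e` that fix the domain of
`q` and are corrected along an enumeration of `M`. When a point `y` is added to the finite set `F`
treated so far, `e` is kept on `F` and its range shrinks, and all realizations of `q` at distance
less than `r` from `F ∪ {y}` must be mapped into `S`.

The realizations that are fresh (at distance at least `r` from `F`, less than `r` from `y`) have
finitely many profiles over `F ∪ {y}`, and one profile is treated at a time, inside a copy `H` with
a finite subset `K` that contains the image of `F`. The image of a fresh point realizes over `K` a
Katětov function of rank `r` that extends `q`, so extendibility gives a smaller copy `H'` and a
Katětov function `g` of rank `r⁻` whose orbit in `H'` is contained in `S`. Fresh points have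
distance at most `r⁻` from `y`, hence at most `2 r⁻` from each other, so all those with the given
profile can realize `g` simultaneously, and free amalgamation over the set of distances `D` extends
this to an embedding of `M` into `H'`. A fresh point with another profile is at a distance `a > 0`
from each of these, so its image has distance at least `min r (r⁻ + a) = r` from the domain of `g`,
and its profile can be treated next. -/

namespace UrysohnExt

open Set

section CrossDistance

/-- `ρ x y` is the distance of `x` and `y` in a pseudometric on `X ⊕ Y` that extends the
pseudometrics of `X` and `Y`. -/
structure IsCrossDist {X Y : Type*} [PseudoMetricSpace X] [PseudoMetricSpace Y]
    (ρ : X → Y → ℝ) : Prop where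
  le_left : ∀ x x' y, ρ x y ≤ dist x x' + ρ x' y
  dist_left : ∀ x x' y, dist x x' ≤ ρ x y + ρ x' y
  le_right : ∀ x y y', ρ x y ≤ ρ x y' + dist y' y
  dist_right : ∀ x y y', dist y y' ≤ ρ x y + ρ x y'

variable {X Y : Type*} [PseudoMetricSpace X] [PseudoMetricSpace Y] {ρ : X → Y → ℝ}

/-- The pseudometric on the disjoint union given by a cross distance. -/
abbrev IsCrossDist.pseudoMetricSpace (h : IsCrossDist ρ) : PseudoMetricSpace (X ⊕ Y) where
  dist
    | .inl x, .inl x' => dist x x'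
    | .inl x, .inr y => ρ x y
    | .inr y, .inl x => ρ x y
    | .inr y, .inr y' => dist y y'
  dist_self := by rintro (x | y) <;> exact dist_self _
  dist_comm := by rintro (x | y) (x' | y') <;> first | exact dist_comm _ _ | rfl
  dist_triangle := by
    rintro (x | y) (x' | y') (x'' | y'')
    · exact dist_triangle _ _ _
    · exact h.le_left _ _ _
    · exact h.dist_left _ _ _
    · exact h.le_right _ _ _
    · exact (h.le_left x'' x' y).trans_eq (by rw [dist_comm, add_comm])
    · exact h.dist_right _ _ _
    · exact (h.le_right x'' y y').trans_eq (by rw [dist_comm, add_comm])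
    · exact dist_triangle _ _ _

lemma IsCrossDist.comp_isometry {X' Y' : Type*} [PseudoMetricSpace X'] [PseudoMetricSpace Y']
    (h : IsCrossDist ρ) {f : X' → X} {g : Y' → Y} (hf : Isometry f) (hg : Isometry g) :
    IsCrossDist fun x y => ρ (f x) (g y) where
  le_left x x' y := by rw [← hf.dist_eq]; exact h.le_left _ _ _
  dist_left x x' y := by rw [← hf.dist_eq]; exact h.dist_left _ _ _
  le_right x y y' := by rw [← hg.dist_eq]; exact h.le_right _ _ _
  dist_right x y y' := by rw [← hg.dist_eq]; exact h.dist_right _ _ _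

end CrossDistance

section Amalgamation

/-- The truncated sum `a ⊕ b`: the largest element of `D` that is at most `a + b`. -/
noncomputable def truncAdd (D : Set ℝ) (a b : ℝ) : ℝ := sSup {x ∈ D | x ≤ a + b}

/-- The four-values condition on a set of distances, in the form of associativity of the
truncated sum: `s ≤ (a ⊕ b) ⊕ c` implies `s ≤ a ⊕ (b ⊕ c)`. -/
def FourValues (D : Set ℝ) : Prop :=
  ∀ ⦃a b c s t : ℝ⦄, a ∈ D → b ∈ D → c ∈ D → s ∈ D → t ∈ D →
    t ≤ a + b → s ≤ t + c → s ≤ a + truncAdd D b c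

variable {D : Set ℝ} {a b c : ℝ}

lemma truncAdd_comm (D : Set ℝ) (a b : ℝ) : truncAdd D a b = truncAdd D b a := by
  simp only [truncAdd, add_comm]

lemma isGreatest_truncAdd (hD : D.Finite) (ha : a ∈ D) (hb : 0 ≤ b) :
    IsGreatest {x ∈ D | x ≤ a + b} (truncAdd D a b) := by
  have hfin : {x ∈ D | x ≤ a + b}.Finite := hD.subset fun _ hx => hx.1
  exact ⟨Set.Nonempty.csSup_mem ⟨a, ha, le_add_of_nonneg_right hb⟩ hfin,
    fun _ hx => le_csSup hfin.bddAbove hx⟩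

lemma le_truncAdd (hD : D.Finite) (hc : c ∈ D) (h : c ≤ a + b) : c ≤ truncAdd D a b :=
  le_csSup (hD.subset fun _ hx => hx.1).bddAbove ⟨hc, h⟩

variable {P Q ι : Type*} [PseudoMetricSpace P] [PseudoMetricSpace Q] {i : ι → P} {j : ι → Q}

/-- The distance between `p` and `q` in the free amalgam of `P` and `Q` over a common part `ι`,
among the pseudometric spaces with distances in `D`. -/
noncomputable def amalgDist (D : Set ℝ) (i : ι → P) (j : ι → Q) (p : P) (q : Q) : ℝ :=
  ⨅ z, truncAdd D (dist p (i z)) (dist (j z) q)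

lemma amalgDist_comm (p : P) (q : Q) : amalgDist D i j p q = amalgDist D j i q p := by
  simp only [amalgDist, dist_comm p, dist_comm _ q, truncAdd_comm D (dist _ p)]

lemma le_amalgDist [Nonempty ι] (hD : D.Finite) (hc : c ∈ D) {p : P} {q : Q}
    (h : ∀ z, c ≤ dist p (i z) + dist (j z) q) : c ≤ amalgDist D i j p q :=
  le_ciInf fun z => le_truncAdd hD hc (h z)

lemma finite_range_truncAdd_dist (hD : D.Finite) (hP : ∀ p p' : P, dist p p' ∈ D) (p : P)
    (q : Q) : (range fun z => truncAdd D (dist p (i z)) (dist (j z) q)).Finite :=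
  hD.subset <| range_subset_iff.2 fun z =>
    (isGreatest_truncAdd hD (hP p (i z)) dist_nonneg).1.1

lemma exists_amalgDist_eq [Nonempty ι] (i : ι → P) (j : ι → Q) (hD : D.Finite)
    (hP : ∀ p p' : P, dist p p' ∈ D) (p : P) (q : Q) :
    ∃ z, amalgDist D i j p q = truncAdd D (dist p (i z)) (dist (j z) q) := by
  obtain ⟨z, hz⟩ := (range_nonempty fun z => truncAdd D (dist p (i z)) (dist (j z) q)).csInf_mem
    (finite_range_truncAdd_dist hD hP p q)
  exact ⟨z, hz.symm⟩

lemma amalgDist_mem [Nonempty ι] (hD : D.Finite) (hP : ∀ p p' : P, dist p p' ∈ D) (p : P)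
    (q : Q) : amalgDist D i j p q ∈ D := by
  obtain ⟨z, hz⟩ := exists_amalgDist_eq i j hD hP p q
  exact hz ▸ (isGreatest_truncAdd hD (hP p (i z)) dist_nonneg).1.1

lemma amalgDist_le (hD : D.Finite) (hP : ∀ p p' : P, dist p p' ∈ D) (p : P) (q : Q) (z : ι) :
    amalgDist D i j p q ≤ truncAdd D (dist p (i z)) (dist (j z) q) :=
  ciInf_le (finite_range_truncAdd_dist hD hP p q).bddBelow z

lemma amalgDist_le_amalgDist [Nonempty ι] (hD : D.Finite) (hP : ∀ p p' : P, dist p p' ∈ D)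
    {p p' : P} {q q' : Q}
    (h : ∀ z, ∃ z', dist p (i z') = dist p' (i z) ∧ dist (j z') q = dist (j z) q') :
    amalgDist D i j p q ≤ amalgDist D i j p' q' :=
  le_ciInf fun z => by
    obtain ⟨z', hp, hq⟩ := h z
    rw [← hp, ← hq]
    exact amalgDist_le hD hP p q z'

lemma amalgDist_le_dist_add [Nonempty ι] (hD : D.Finite) (h4 : FourValues D)
    (hP : ∀ p p' : P, dist p p' ∈ D) (hQ : ∀ q q' : Q, dist q q' ∈ D) (p p' : P) (q : Q) :
    amalgDist D i j p q ≤ dist p p' + amalgDist D i j p' q := by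
  obtain ⟨z, hz⟩ := exists_amalgDist_eq i j hD hP p' q
  obtain ⟨⟨hmem, hle⟩, -⟩ :=
    isGreatest_truncAdd hD (hP p (i z)) (dist_nonneg (x := j z) (y := q))
  rw [hz]
  exact (amalgDist_le hD hP p q z).trans
    (h4 (hP _ _) (hP _ _) (hQ _ _) hmem (hP _ _) (dist_triangle p p' (i z)) hle)

lemma dist_le_amalgDist_add_dist [Nonempty ι] (hD : D.Finite) (h4 : FourValues D)
    (hP : ∀ p p' : P, dist p p' ∈ D) (hQ : ∀ q q' : Q, dist q q' ∈ D)
    (hij : ∀ z z', dist (i z) (i z') = dist (j z) (j z')) (p : P) (q : Q) (z : ι) :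
    dist p (i z) ≤ amalgDist D i j p q + dist (j z) q := by
  obtain ⟨z', hz'⟩ := exists_amalgDist_eq i j hD hP p q
  rw [hz', add_comm, truncAdd_comm]
  refine h4 (hQ _ _) (hQ _ _) (hP _ _) (hP _ _) (hQ (j z) (j z'))
    (dist_triangle_right _ _ _) ?_
  rw [← hij, add_comm, dist_comm (i z)]
  exact dist_triangle _ _ _

lemma dist_le_amalgDist_add_amalgDist [Nonempty ι] (hD : D.Finite) (h4 : FourValues D)
    (hP : ∀ p p' : P, dist p p' ∈ D) (hQ : ∀ q q' : Q, dist q q' ∈ D)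
    (hij : ∀ z z', dist (i z) (i z') = dist (j z) (j z')) (p p' : P) (q : Q) :
    dist p p' ≤ amalgDist D i j p q + amalgDist D i j p' q := by
  obtain ⟨z, hz⟩ := exists_amalgDist_eq i j hD hP p q
  rw [hz, add_comm, truncAdd_comm]
  refine h4 (amalgDist_mem hD hP p' q) (hQ _ _) (hP _ _) (hP _ _) (hP p' (i z))
    (dist_le_amalgDist_add_dist hD h4 hP hQ hij p' q z) ?_
  rw [add_comm, dist_comm p']
  exact dist_triangle _ _ _

lemma isCrossDist_amalgDist [Nonempty ι] (hD : D.Finite) (h4 : FourValues D)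
    (hP : ∀ p p' : P, dist p p' ∈ D) (hQ : ∀ q q' : Q, dist q q' ∈ D)
    (hij : ∀ z z', dist (i z) (i z') = dist (j z) (j z')) : IsCrossDist (amalgDist D i j) where
  le_left := amalgDist_le_dist_add hD h4 hP hQ
  dist_left := dist_le_amalgDist_add_amalgDist hD h4 hP hQ hij
  le_right p q q' := by
    rw [add_comm, dist_comm, amalgDist_comm p, amalgDist_comm p]
    exact amalgDist_le_dist_add hD h4 hQ hP q q' p
  dist_right p q q' := by
    rw [amalgDist_comm p, amalgDist_comm p]
    exact dist_le_amalgDist_add_amalgDist hD h4 hQ hP (fun z z' => (hij z z').symm) q q' p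

lemma amalgDist_left (hD : D.Finite) (hP : ∀ p p' : P, dist p p' ∈ D)
    (hQ : ∀ q q' : Q, dist q q' ∈ D) (hij : ∀ z z', dist (i z) (i z') = dist (j z) (j z'))
    (z : ι) (q : Q) : amalgDist D i j (i z) q = dist (j z) q := by
  have : Nonempty ι := ⟨z⟩
  apply le_antisymm
  · calc amalgDist D i j (i z) q
      _ ≤ truncAdd D (dist (i z) (i z)) (dist (j z) q) := amalgDist_le hD hP _ _ z
      _ ≤ dist (i z) (i z) + dist (j z) q := (isGreatest_truncAdd hD (hP _ _) dist_nonneg).1.2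
      _ = dist (j z) q := by rw [dist_self, zero_add]
  · refine le_amalgDist hD (hQ _ _) fun z' => ?_
    rw [hij]
    exact dist_triangle _ _ _

lemma amalgDist_right (hD : D.Finite) (hP : ∀ p p' : P, dist p p' ∈ D)
    (hQ : ∀ q q' : Q, dist q q' ∈ D) (hij : ∀ z z', dist (i z) (i z') = dist (j z) (j z'))
    (p : P) (z : ι) : amalgDist D i j p (j z) = dist p (i z) := by
  rw [amalgDist_comm, amalgDist_left hD hQ hP (fun z z' => (hij z z').symm), dist_comm]

end Amalgamation

section Fusion

/-- `e` is the pointwise limit of successive corrections along an enumeration of `X`. -/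
lemma exists_fusion {X Y : Type*} [Countable X] [DecidableEq X] (P : Finset X → (X → Y) → Prop)
    {A : Finset X} {e₀ : X → Y} (h₀ : P A e₀)
    (step : ∀ F e y, P F e → ∃ e', P (insert y F) e' ∧ EqOn e' e F) :
    ∃ e : X → Y, ∀ G : Finset X, ∃ F f, G ⊆ F ∧ P F f ∧ EqOn e f F := by
  cases isEmpty_or_nonempty X
  · exact ⟨e₀, fun G => ⟨A, e₀, fun x => isEmptyElim x, h₀, fun _ _ => rfl⟩⟩
  obtain ⟨x, hx⟩ := exists_surjective_nat X
  choose! next hnextP hnext using step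
  let F : ℕ → Finset X := fun n => Nat.rec A (fun n F => insert (x n) F) n
  let E : ℕ → X → Y := fun n => Nat.rec e₀ (fun n e => next (F n) e (x n)) n
  have hP (n : ℕ) : P (F n) (E n) := by
    induction n with
    | zero => exact h₀
    | succ n ih => exact hnextP _ _ _ ih
  have hF : Monotone F := monotone_nat_of_le_succ fun n => Finset.subset_insert _ _
  have hE {n m : ℕ} (hnm : n ≤ m) : ∀ w ∈ F n, E m w = E n w := by
    induction m, hnm using Nat.le_induction with
    | base => exact fun _ _ => rfl
    | succ m hnm ih => exact fun w hw => (hnext _ _ _ (hP m) (hF hnm hw)).trans (ih w hw)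
  choose index hindex using hx
  have hmem (w : X) : w ∈ F (index w + 1) :=
    Finset.mem_insert.2 (Or.inl (hindex w).symm)
  refine ⟨fun w => E (index w + 1) w, fun G =>
    ⟨F (G.sup fun w => index w + 1), E _, fun w hw => ?_, hP _, fun w hw => ?_⟩⟩
  · exact hF (Finset.le_sup (f := fun w => index w + 1) hw) (hmem w)
  · rcases le_total (index w + 1) (G.sup fun w => index w + 1) with h | h
    · exact (hE h w (hmem w)).symm
    · exact hE h w hw

end Fusion

section Urysohn

variable {M : Type*} [MetricSpace M] {D : Set ℝ}

lemma IsCountableUrysohn.dist_mem (hM : IsCountableUrysohn D M) (x y : M) : dist x y ∈ D :=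
  hM.dist_range ▸ mem_range_self (x, y)

lemma IsCountableUrysohn.exists_isometry_of_finite (hM : IsCountableUrysohn D M) {X : Type*}
    [PseudoMetricSpace X] [Finite X] (hX : ∀ x y : X, dist x y ∈ D) :
    ∃ e : X → M, Isometry e := by
  have : Finite (SeparationQuotient X) := Quotient.finite _
  obtain ⟨n, ⟨φ⟩⟩ := Finite.exists_equiv_fin (SeparationQuotient X)
  let _ : MetricSpace (Fin n) := .induced φ.symm φ.symm.injective inferInstance
  have hφ (a b : Fin n) : dist a b = dist (φ.symm a) (φ.symm b) := rfl
  obtain ⟨f, hf⟩ := hM.universal (Fin n) fun a b => by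
    obtain ⟨x, hx⟩ := SeparationQuotient.surjective_mk (φ.symm a)
    obtain ⟨y, hy⟩ := SeparationQuotient.surjective_mk (φ.symm b)
    rw [hφ, ← hx, ← hy, SeparationQuotient.dist_mk]
    exact hX x y
  refine ⟨fun x => f (φ (SeparationQuotient.mk x)), Isometry.of_dist_eq fun x y => ?_⟩
  rw [hf.dist_eq, hφ, φ.symm_apply_apply, φ.symm_apply_apply, SeparationQuotient.dist_mk]

lemma IsCountableUrysohn.exists_isometryEquiv (hM : IsCountableUrysohn D M) {ι : Type*}
    [Finite ι] (f g : ι → M) (hfg : ∀ a b, dist (f a) (f b) = dist (g a) (g b)) :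
    ∃ φ : M ≃ᵢ M, ∀ a, φ (f a) = g a := by
  have hmem (u : (finite_range f).toFinset) : ∃ a, f a = u := (finite_range f).mem_toFinset.1 u.2
  choose pre hpre using hmem
  obtain ⟨φ, hφ⟩ := hM.homogeneous _ (fun u => g (pre u)) <| Isometry.of_dist_eq fun u v => by
    rw [← hfg, hpre, hpre, Subtype.dist_eq]
  refine ⟨φ, fun a => ?_⟩
  let u : (finite_range f).toFinset := ⟨f a, by simp⟩
  calc φ (f a)
    _ = g (pre u) := hφ u
    _ = g a := by rw [← dist_eq_zero, ← hfg, hpre, dist_self]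

lemma IsCountableUrysohn.exists_isometry_extending_of_finite (hM : IsCountableUrysohn D M)
    {X ι : Type*} [PseudoMetricSpace X] [Finite X] [Finite ι] (hX : ∀ x y : X, dist x y ∈ D)
    (i : ι → X) (f : ι → M) (hif : ∀ a b, dist (i a) (i b) = dist (f a) (f b)) :
    ∃ e : X → M, Isometry e ∧ ∀ a, e (i a) = f a := by
  obtain ⟨e, he⟩ := hM.exists_isometry_of_finite hX
  obtain ⟨φ, hφ⟩ := hM.exists_isometryEquiv (fun a => e (i a)) f fun a b => by
    rw [he.dist_eq, hif]
  exact ⟨φ ∘ e, φ.isometry.comp he, hφ⟩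

lemma IsCountableUrysohn.exists_dist_eq [Nonempty M] (hM : IsCountableUrysohn D M) {ι : Type*}
    [Finite ι] (y : ι → M) (p : ι → ℝ) (hpD : ∀ a, p a ∈ D)
    (hp : ∀ a b, p a ≤ p b + dist (y b) (y a)) (hy : ∀ a b, dist (y a) (y b) ≤ p a + p b) :
    ∃ z, ∀ a, dist z (y a) = p a := by
  let _ : PseudoMetricSpace ι := .induced y inferInstance
  have hρ : IsCrossDist fun (_ : Unit) a => p a := by
    refine ⟨fun _ _ _ => ?_, fun _ _ a => ?_, fun _ a b => hp a b, fun _ a b => hy a b⟩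
    · simp
    · simpa using hy a a
  let _ := hρ.pseudoMetricSpace
  have hX : ∀ u v : Unit ⊕ ι, dist u v ∈ D := by
    rintro (_ | a) (_ | b)
    · rw [dist_self, ← dist_self (Classical.arbitrary M)]
      exact hM.dist_mem _ _
    · exact hpD b
    · exact hpD a
    · exact hM.dist_mem (y a) (y b)
  obtain ⟨e, he, hey⟩ :=
    hM.exists_isometry_extending_of_finite hX Sum.inr y fun _ _ => rfl
  exact ⟨e (.inl ()), fun a => by rw [← hey, he.dist_eq]; rfl⟩

lemma IsCountableUrysohn.exists_extension_insert [Nonempty M] (hM : IsCountableUrysohn D M)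
    {X : Type*} [PseudoMetricSpace X] [DecidableEq X] (hX : ∀ x y : X, dist x y ∈ D)
    {F : Finset X} {e : X → M} (he : ∀ x ∈ F, ∀ y ∈ F, dist (e x) (e y) = dist x y) (y : X) :
    ∃ e' : X → M,
      (∀ x ∈ insert y F, ∀ x' ∈ insert y F, dist (e' x) (e' x') = dist x x') ∧ EqOn e' e F := by
  by_cases hy : y ∈ F
  · exact ⟨e, by rwa [Finset.insert_eq_of_mem hy], fun _ _ => rfl⟩
  obtain ⟨z, hz⟩ := hM.exists_dist_eq (fun x : F => e x) (fun x => dist y x) (fun x => hX y x)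
    (fun x x' => by rw [he _ x'.2 _ x.2]; exact dist_triangle _ _ _)
    (fun x x' => by rw [he _ x.2 _ x'.2]; exact dist_triangle_left _ _ _)
  have hzF : EqOn (Function.update e y z) e F := fun x hx =>
    Function.update_of_ne (ne_of_mem_of_not_mem hx hy) _ _
  have hzx (x) (hx : x ∈ F) : dist z (e x) = dist y x := hz ⟨x, hx⟩
  refine ⟨Function.update e y z, ?_, hzF⟩
  simp only [Finset.forall_mem_insert, Function.update_self, dist_self, true_and]
  refine ⟨fun x hx => by rw [hzF hx, hzx x hx], fun x hx => ⟨?_, fun x' hx' => ?_⟩⟩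
  · rw [hzF hx, dist_comm, hzx x hx, dist_comm]
  · rw [hzF hx, hzF hx', he x hx x' hx']

lemma IsCountableUrysohn.exists_isometry_extending [Nonempty M] (hM : IsCountableUrysohn D M)
    {X ι : Type*} [PseudoMetricSpace X] [Countable X] [Finite ι] (hX : ∀ x y : X, dist x y ∈ D)
    (i : ι → X) (f : ι → M) (hif : ∀ a b, dist (i a) (i b) = dist (f a) (f b)) :
    ∃ e : X → M, Isometry e ∧ ∀ a, e (i a) = f a := by
  classical
  have hfac : f.FactorsThrough i := fun a b hab => by
    rw [← dist_eq_zero, ← hif, hab, dist_self]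
  let e₀ : X → M := Function.extend i f fun _ => Classical.arbitrary M
  have he₀ (a : ι) : e₀ (i a) = f a := hfac.extend_apply _ a
  let P (F : Finset X) (e : X → M) : Prop :=
    (∀ x ∈ F, ∀ y ∈ F, dist (e x) (e y) = dist x y) ∧ ∀ a, i a ∈ F ∧ e (i a) = f a
  have h₀ : P (finite_range i).toFinset e₀ := by simp [P, he₀, hif]
  obtain ⟨e, he⟩ := exists_fusion P h₀ fun F e y ⟨hF, hif⟩ => by
    obtain ⟨e', he', hee'⟩ := hM.exists_extension_insert hX hF y
    exact ⟨e', ⟨he', fun a => ⟨Finset.mem_insert_of_mem (hif a).1,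
      (hee' (hif a).1).trans (hif a).2⟩⟩, hee'⟩
  refine ⟨e, Isometry.of_dist_eq fun x y => ?_, fun a => ?_⟩
  · obtain ⟨F, f', hxy, ⟨hF, -⟩, hef⟩ := he {x, y}
    have hx : x ∈ F := hxy (by simp)
    have hy : y ∈ F := hxy (by simp)
    rw [hef hx, hef hy, hF x hx y hy]
  · obtain ⟨F, f', -, ⟨-, hF⟩, hef⟩ := he ∅
    exact (hef (hF a).1).trans (hF a).2

lemma IsCountableUrysohn.fourValues (hD : D.Finite) (hM : IsCountableUrysohn D M) :
    FourValues D := by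
  intro a b c s t ha hb hc hs ht htab hstc
  have hpos {u : ℝ} (hu : u ∈ D) : 0 ≤ u := by
    obtain ⟨⟨x, y⟩, rfl⟩ := hM.dist_range ▸ hu
    exact dist_nonneg
  have hbu : b ≤ truncAdd D b c := le_truncAdd hD hb (le_add_of_nonneg_right (hpos hc))
  have hcu : c ≤ truncAdd D b c := le_truncAdd hD hc (le_add_of_nonneg_left (hpos hb))
  rcases le_or_gt s (a + b) with hab | hab
  · linarith
  rcases le_or_gt s (a + c) with hac | hac
  · linarith
  rcases le_or_gt s (b + c) with hbc | hbc
  · exact le_add_of_nonneg_of_le (hpos ha) (le_truncAdd hD hs hbc)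
  obtain ⟨⟨x, z⟩, rfl⟩ := hM.dist_range ▸ ht
  have : Nonempty M := ⟨x⟩
  dsimp only at htab hstc
  have exists_point {p p' : ℝ} (hp : p ∈ D) (hp' : p' ∈ D) (h : p ≤ p' + dist x z)
      (h' : p' ≤ p + dist x z) (hxz : dist x z ≤ p + p') : ∃ y, dist y x = p ∧ dist y z = p' := by
    obtain ⟨y, hy⟩ := hM.exists_dist_eq ![x, z] ![p, p'] (Fin.forall_fin_two.2 ⟨hp, hp'⟩)
      (by simp [Fin.forall_fin_two, dist_comm z, h, h'])
      (by simp [Fin.forall_fin_two, dist_comm z, hxz, add_comm p', hpos hp, hpos hp'])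
    exact ⟨y, hy 0, hy 1⟩
  obtain ⟨y, hyx, hyz⟩ := exists_point ha hb (by linarith) (by linarith) htab
  obtain ⟨w, hwx, hwz⟩ := exists_point hs hc (by linarith) (by linarith [hpos ha, hpos hb])
    (by linarith [hpos ha, hpos hc])
  have hyw : dist y w ≤ truncAdd D b c :=
    le_truncAdd hD (hM.dist_mem y w) (hyz ▸ hwz ▸ dist_triangle_right y w z)
  calc s
    _ = dist x w := by rw [dist_comm, hwx]
    _ ≤ dist y x + dist y w := dist_triangle_left x w y
    _ ≤ a + truncAdd D b c := by rw [hyx]; gcongr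

end Urysohn

section Copy

variable {M : Type*} [MetricSpace M] {D : Set ℝ} {H : Set M}

lemma IsCopy.range_comp {φ : H → M} (hH : IsCopy H) (hφ : Isometry φ) : IsCopy (range φ) := by
  obtain ⟨h, hh, rfl⟩ := hH
  refine ⟨fun x => φ (rangeFactorization h x), ?_, rangeFactorization_surjective.range_comp φ⟩
  exact hφ.comp (Isometry.of_dist_eq hh.dist_eq)

lemma IsCountableUrysohn.exists_isometry_into_copy [Nonempty M] (hM : IsCountableUrysohn D M)
    (hH : IsCopy H) {X ι : Type*} [PseudoMetricSpace X] [Countable X] [Finite ι]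
    (hX : ∀ x y : X, dist x y ∈ D) (i : ι → X) (f : ι → H)
    (hif : ∀ a b, dist (i a) (i b) = dist (f a) (f b)) :
    ∃ e : X → M, Isometry e ∧ (∀ x, e x ∈ H) ∧ ∀ a, e (i a) = f a := by
  obtain ⟨h, hh, rfl⟩ := hH
  choose pre hpre using fun a => (f a).2
  obtain ⟨e, he, hei⟩ := hM.exists_isometry_extending hX i pre fun a b => by
    rw [hif, Subtype.dist_eq, ← hpre, ← hpre, hh.dist_eq]
  exact ⟨h ∘ e, hh.comp he, fun x => ⟨e x, rfl⟩, fun a => by rw [← hpre, ← hei]; rfl⟩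

lemma IsCrossDist.exists_isometry_into_copy [Nonempty M] (hM : IsCountableUrysohn D M)
    (hH : IsCopy H) {K : Finset M} (hKH : (K : Set M) ⊆ H) {X : Type*} [PseudoMetricSpace X]
    [Countable X] (hX : ∀ x y : X, dist x y ∈ D) {ρ : X → K → ℝ} (hρ : IsCrossDist ρ)
    (hρD : ∀ x k, ρ x k ∈ D) :
    ∃ e : X → M, Isometry e ∧ (∀ x, e x ∈ H) ∧ ∀ x (k : K), dist (e x) k = ρ x k := by
  let _ := hρ.pseudoMetricSpace
  have hXK : ∀ u v : X ⊕ K, dist u v ∈ D := by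
    rintro (x | k) (x' | k')
    · exact hX x x'
    · exact hρD x k'
    · exact hρD x' k
    · exact hM.dist_mem (k : M) k'
  obtain ⟨e, he, heH, hei⟩ := hM.exists_isometry_into_copy hH hXK Sum.inr
    (fun k : K => ⟨k, hKH k.2⟩) fun _ _ => rfl
  refine ⟨e ∘ Sum.inl, he.comp (Isometry.of_dist_eq fun _ _ => rfl), fun x => heH _,
    fun x k => ?_⟩
  rw [← hei k]
  exact he.dist_eq _ _

end Copy

section Katetov

variable {M : Type*} [MetricSpace M] {D : Set ℝ} {r : ℝ} {p : TypeFn M}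

/-- The points of `M` that realize `p`. For a Katětov function these are the points of the orbit
of `p`, since its values are nonzero. -/
def TypeFn.realizations (p : TypeFn M) : Set M := {w | ∀ x ∈ p.dom, dist w x = p.val x}

/-- The type function over `K` realized by the point `u`. -/
def TypeFn.ofPoint (K : Finset M) (u : M) : TypeFn M := ⟨K, dist u⟩

lemma TypeFn.isKatetov_ofPoint (hM : IsCountableUrysohn D M) {K : Finset M} {u : M}
    (hu : u ∉ K) : (TypeFn.ofPoint K u).IsKatetov D := by
  let pt : Option K → M := fun a => a.elim u (↑)
  have hpt (a b : Option K) : (TypeFn.ofPoint K u).spDist a b = dist (pt a) (pt b) := by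
    obtain _ | a := a <;> obtain _ | b := b
    · exact (dist_self u).symm
    · rfl
    · exact dist_comm u a
    · rfl
  have hinj : Function.Injective pt := by
    rintro (_ | a) (_ | b) hab
    · rfl
    · exact (hu ((show u = b from hab) ▸ b.2)).elim
    · exact (hu ((show (a : M) = u from hab) ▸ a.2)).elim
    · exact congrArg some (Subtype.ext hab)
  simp only [TypeFn.IsKatetov, TypeFn.ofPoint] at hpt ⊢
  refine ⟨fun a b => ?_, fun a b => ?_, fun a b => ?_, fun a b c => ?_⟩
  · exact hpt a b ▸ hM.dist_mem _ _
  · rw [hpt, dist_eq_zero, hinj.eq_iff]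
  · rw [hpt, hpt, dist_comm]
  · rw [hpt, hpt, hpt]; exact dist_triangle _ _ _

lemma TypeFn.IsKatetov.val_mem (hp : p.IsKatetov D) {x : M} (hx : x ∈ p.dom) : p.val x ∈ D :=
  hp.1 none (some ⟨x, hx⟩)

lemma TypeFn.IsKatetov.val_pos (hp : p.IsKatetov D) {x : M} (hx : x ∈ p.dom) : 0 < p.val x := by
  have h := hp.2.2.2 none (some ⟨x, hx⟩) none
  have hne : p.val x ≠ 0 := fun h0 => Option.some_ne_none _ ((hp.2.1 none (some ⟨x, hx⟩)).1 h0).symm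
  simp only [TypeFn.spDist] at h
  exact lt_of_le_of_ne (by linarith) hne.symm

lemma TypeFn.IsKatetov.isCrossDist (hp : p.IsKatetov D) {X : Type*} [PseudoMetricSpace X]
    (hX : ∀ x x' : X, ∀ k ∈ p.dom, dist x x' ≤ p.val k + p.val k) :
    IsCrossDist fun (_ : X) (k : p.dom) => p.val k where
  le_left _ _ _ := le_add_of_nonneg_left dist_nonneg
  dist_left x x' k := hX x x' k k.2
  le_right _ k k' := hp.2.2.2 none (some k') (some k)
  dist_right _ k k' := hp.2.2.2 (some k) none (some k')

lemma TypeFn.IsKatetov.orb_eq (hp : p.IsKatetov D) (H : Set M) :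
    p.orb H = H ∩ p.realizations := by
  ext u
  refine ⟨fun hu => ⟨hu.1, hu.2.2⟩, fun hu => ⟨hu.1, fun hup => ?_, hu.2⟩⟩
  exact (hp.val_pos hup).ne ((dist_self u).symm.trans (hu.2 u hup))

lemma TypeFn.IsKatetov.rank_mem (hp : p.IsKatetov D) (hr : p.HasRank r) : r ∈ D := by
  obtain ⟨⟨x, hx, rfl⟩, -⟩ := hr
  exact hp.val_mem hx

lemma TypeFn.IsKatetov.rank_pos (hp : p.IsKatetov D) (hr : p.HasRank r) : 0 < r := by
  obtain ⟨⟨x, hx, rfl⟩, -⟩ := hr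
  exact hp.val_pos hx

lemma ExtendibleInto.exists_subcopy {S : Set M} {q : TypeFn M} (hM : IsCountableUrysohn D M)
    (hext : ExtendibleInto D r S q) {H : Set M} (hH : IsCopy H) {K : Finset M}
    (hKH : (K : Set M) ⊆ H) (hqK : q.dom ⊆ K) {u : M} (huq : u ∈ q.realizations)
    (hu : ∀ k ∈ K, r ≤ dist u k) :
    ∃ H' g, IsCopy H' ∧ H' ⊆ H ∧ g.IsKatetov D ∧ g.HasRank (below D r) ∧
      (TypeFn.ofPoint K u).Sub g ∧ (g.dom : Set M) ⊆ H' ∧ H' ∩ g.realizations ⊆ S := by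
  obtain ⟨hq, hrank, hext⟩ := hext
  have huK : u ∉ K := fun h => by simpa using (hq.rank_pos hrank).trans_le (hu u h)
  have hrankK : (TypeFn.ofPoint K u).HasRank r := by
    refine ⟨?_, forall_mem_image.2 hu⟩
    obtain ⟨⟨x, hx, hxr⟩, -⟩ := hrank
    exact ⟨x, hqK hx, (huq x hx).trans hxr⟩
  have hqH : (q.dom : Set M) ⊆ H := (Finset.coe_subset.2 hqK).trans hKH
  obtain ⟨α, hα, -, g, hg, hgα, hsub, hgrank, hgS⟩ :=
    hext H hH hqH _ (TypeFn.isKatetov_ofPoint hM huK) hKH ⟨hqK, huq⟩ hrankK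
  refine ⟨_, g, hH.range_comp (isometry_subtype_coe.comp hα), ?_, hg, hgrank, hsub, hgα, ?_⟩
  · exact range_subset_iff.2 fun x => (α x).2
  · rwa [hg.orb_eq] at hgS

end Katetov

section Block

variable {D B : Set ℝ} {m r a : ℝ}

lemma le_below (hD : D.Finite) (ha : a ∈ D) (h0 : 0 ≤ a) (har : a < r) : a ≤ below D r :=
  le_csSup (hD.subset fun _ hx => hx.2).bddAbove ⟨⟨h0, har⟩, ha⟩

lemma IsBlock.le_below_add (hD : D.Finite) (hB : IsBlock D B) (hm : IsLeast B m) (hr : r ∈ B)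
    (hmr : m < r) : r ≤ below D r + m := by
  obtain ⟨hBD, n, b, rfl, hb0, hlt, -, -, hgap⟩ := hB
  have hmono : StrictMono b := Fin.strictMono_iff_lt_succ.2 hlt
  have hleast : IsLeast (range b) (b 0) :=
    ⟨mem_range_self 0, forall_mem_range.2 fun i => hmono.monotone (Fin.zero_le i)⟩
  obtain rfl : m = b 0 := hm.unique hleast
  obtain ⟨j, rfl⟩ := hr
  obtain ⟨i, rfl⟩ := Fin.exists_succ_eq.2 (show j ≠ 0 by rintro rfl; exact hmr.false)
  calc b i.succ
    _ ≤ b i.castSucc + b 0 := hgap i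
    _ ≤ below D (b i.succ) + b 0 := by
      gcongr
      exact le_below hD (hBD ⟨_, rfl⟩) (hb0.le.trans (hmono.monotone (Fin.zero_le _))) (hlt i)

lemma IsFirstBlock.le_below_add (hD : D.Finite) (hB : IsFirstBlock D B) (hm : IsLeast B m)
    (hr : r ∈ B) (hmr : m < r) (ha : a ∈ D) (ha0 : 0 < a) : r ≤ below D r + a := by
  obtain ⟨⟨hblock, m', hm', hleast⟩, -⟩ := hB
  calc r
    _ ≤ below D r + m := hblock.le_below_add hD hm hr hmr
    _ ≤ below D r + a := by
      gcongr
      exact hm.unique hm' ▸ hleast.2 ⟨ha, ha0.ne'⟩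

end Block

section Construction

variable {M : Type*} [MetricSpace M] {D : Set ℝ} {r : ℝ} {S : Set M} {q : TypeFn M}

/-- The possible values of `profile F`. -/
abbrev Profile (F : Finset M) : Type _ := F → ℝ

/-- The distances from `w` to the points of `F`. In a Urysohn space, two points have the same
profile over `F` if and only if they are in the same orbit of the pointwise stabilizer of `F`. -/
def profile (F : Finset M) (w : M) : Profile F := fun x => dist w x

variable {F K : Finset M} {H : Set M} {e e' : M → M} {w w' v y : M}

lemma dist_eq_of_profile_eq (h : profile F w = profile F w') {x : M} (hx : x ∈ F) :
    dist w x = dist w' x :=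
  congrFun h ⟨x, hx⟩

lemma finite_range_profile (hD : D.Finite) (hM : IsCountableUrysohn D M) (F : Finset M) :
    (range (profile F)).Finite :=
  (Finite.pi fun _ : F => hD).subset <| range_subset_iff.2 fun w x _ => hM.dist_mem w x

lemma exists_isometryEquiv_of_profile_eq (hM : IsCountableUrysohn D M)
    (h : profile F w = profile F w') : ∃ φ : M ≃ᵢ M, (∀ x ∈ F, φ x = x) ∧ φ w = w' := by
  let pts (u : M) (a : Option F) : M := a.elim u (↑)
  obtain ⟨φ, hφ⟩ := hM.exists_isometryEquiv (pts w) (pts w') <| by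
    rintro (_ | a) (_ | b)
    · simp [pts]
    · exact dist_eq_of_profile_eq h b.2
    · exact (dist_comm _ _).trans ((dist_eq_of_profile_eq h a.2).trans (dist_comm _ _))
    · rfl
  exact ⟨φ, fun x hx => hφ (some ⟨x, hx⟩), hφ none⟩

lemma factorsThrough_profile (hM : IsCountableUrysohn D M) {f : M → ℝ}
    (hf : ∀ φ : M ≃ᵢ M, (∀ u, profile F (φ u) = profile F u) → ∀ w, f (φ w) ≤ f w) :
    f.FactorsThrough (profile F) := by
  have hle {w w' : M} (h : profile F w = profile F w') : f w' ≤ f w := by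
    obtain ⟨φ, hφ, rfl⟩ := exists_isometryEquiv_of_profile_eq hM h
    refine hf φ (fun u => funext fun x => ?_) w
    calc dist (φ u) x
      _ = dist (φ u) (φ x) := by rw [hφ x x.2]
      _ = dist u x := φ.dist_eq _ _
  exact fun w w' h => le_antisymm (hle h.symm) (hle h)

lemma exists_isometry_amalgDist [Nonempty M] (hD : D.Finite) (hM : IsCountableUrysohn D M)
    (hH : IsCopy H) (hKH : (K : Set M) ⊆ H) (he : Isometry e) {ι : Type*} [Nonempty ι]
    {i j : ι → M} (hij : ∀ z z', dist (i z) (i z') = dist (j z) (j z')) :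
    ∃ e' : M → M, Isometry e' ∧ (∀ w, e' w ∈ H) ∧
      ∀ w, ∀ k ∈ K, dist (e' w) k = amalgDist D i j (e w) k := by
  have := hM.countable
  have hρ := (isCrossDist_amalgDist hD (hM.fourValues hD) hM.dist_mem hM.dist_mem hij).comp_isometry
    he (isometry_subtype_coe (s := (K : Set M)))
  obtain ⟨e', he', he'H, hdist⟩ := hρ.exists_isometry_into_copy hM hH hKH hM.dist_mem
    fun w k => amalgDist_mem hD hM.dist_mem _ _
  exact ⟨e', he', he'H, fun w k hk => hdist w ⟨k, hk⟩⟩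

/-- The map `e'` comes from the free amalgam of the image of `e` with a realization of `g` by all
points with the profile of `v`. -/
lemma exists_isometry_realizing [Nonempty M] (hD : D.Finite) (hM : IsCountableUrysohn D M)
    (hH : IsCopy H) {g : TypeFn M} (hg : g.IsKatetov D) (hgH : (g.dom : Set M) ⊆ H)
    (he : Isometry e) (hgv : (TypeFn.ofPoint K (e v)).Sub g)
    (hcongr : ∀ k ∈ K, (fun w => dist (e w) k).FactorsThrough (profile F))
    (hdiam : ∀ w w', profile F w = profile F v → profile F w' = profile F v →
      ∀ k ∈ g.dom, dist w w' ≤ g.val k + g.val k) :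
    ∃ e' : M → M, Isometry e' ∧ (∀ w, e' w ∈ H) ∧
      (∀ w, ∀ k ∈ K, dist (e' w) k = dist (e w) k) ∧
      (∀ w, profile F w = profile F v → e' w ∈ g.realizations) ∧
      (∀ k ∈ g.dom, (fun w => dist (e' w) k).FactorsThrough (profile F)) ∧
      ∀ s ∈ D, ∀ w, ∀ k ∈ g.dom,
        (∀ w', profile F w' = profile F v → s ≤ dist w w' + g.val k) →
        (∀ k' ∈ K, s ≤ dist (e w) k') → s ≤ dist (e' w) k := by
  have := hM.countable
  let O := {w // profile F w = profile F v}
  have hgO : IsCrossDist fun (_ : O) (k : g.dom) => g.val k :=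
    hg.isCrossDist fun w w' => hdiam w w' w.2 w'.2
  obtain ⟨c, hc, -, hcg⟩ := hgO.exists_isometry_into_copy hM hH hgH
    (fun w w' : O => hM.dist_mem (w : M) w') fun _ k => hg.val_mem k.2
  have hOK (w : O) (k : K) : dist (e w) k = dist (c w) k := by
    rw [hcg w ⟨k, hgv.1 k.2⟩, hgv.2 k k.2]
    exact hcongr k k.2 w.2
  let i : O ⊕ K → M := Sum.elim (fun w => e w) (↑)
  let j : O ⊕ K → M := Sum.elim c (↑)
  have hij : ∀ z z', dist (i z) (i z') = dist (j z) (j z') := by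
    rintro (w | k) (w' | k')
    · exact (he.dist_eq _ _).trans (hc.dist_eq w w').symm
    · exact hOK w k'
    · exact (dist_comm _ _).trans ((hOK w' k).trans (dist_comm _ _))
    · rfl
  have : Nonempty (O ⊕ K) := ⟨.inl ⟨v, rfl⟩⟩
  obtain ⟨e', he', he'H, hdist⟩ := exists_isometry_amalgDist hD hM hH hgH he hij
  refine ⟨e', he', he'H, fun w k hk => ?_, fun w hw k hk => ?_, fun k hk => ?_,
    fun s hs w k hk hsO hsK => ?_⟩
  · rw [hdist w k (hgv.1 hk)]
    exact amalgDist_right hD hM.dist_mem hM.dist_mem hij (e w) (.inr ⟨k, hk⟩)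
  · rw [hdist w k hk, ← hcg ⟨w, hw⟩ ⟨k, hk⟩]
    exact amalgDist_left hD hM.dist_mem hM.dist_mem hij (.inl ⟨w, hw⟩) k
  · refine factorsThrough_profile hM fun φ hφ w => ?_
    rw [hdist w k hk, hdist (φ w) k hk]
    refine amalgDist_le_amalgDist hD hM.dist_mem ?_
    rintro (u | k')
    · refine ⟨.inl ⟨φ u, (hφ u).trans u.2⟩, ?_, (hcg _ ⟨k, hk⟩).trans (hcg u ⟨k, hk⟩).symm⟩
      exact (he.dist_eq _ _).trans ((φ.dist_eq w u).trans (he.dist_eq _ _).symm)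
    · exact ⟨.inr k', hcongr k' k'.2 (hφ w), rfl⟩
  · rw [hdist w k hk]
    refine le_amalgDist hD hs ?_
    rintro (w' | k')
    · exact (hsO w' w'.2).trans_eq (congrArg₂ _ (he.dist_eq _ _).symm (hcg w' ⟨k, hk⟩).symm)
    · exact le_add_of_le_of_nonneg (hsK k' k'.2) dist_nonneg

/-- The points realizing `q` at distance at least `r` from `F` but less than `r` from `y`. -/
def freshPoints (q : TypeFn M) (r : ℝ) (F : Finset M) (y : M) : Set M :=
  {w ∈ q.realizations | (∀ x ∈ F, r ≤ dist w x) ∧ dist w y < r}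

lemma dist_le_of_mem_freshPoints (hD : D.Finite) (hM : IsCountableUrysohn D M)
    (hw : w ∈ freshPoints q r F y) (hw' : w' ∈ freshPoints q r F y) :
    dist w w' ≤ below D r + below D r :=
  (dist_triangle_right w w' y).trans <| add_le_add
    (le_below hD (hM.dist_mem w y) dist_nonneg hw.2.2)
    (le_below hD (hM.dist_mem w' y) dist_nonneg hw'.2.2)

section Stage

variable [DecidableEq M]

lemma mem_freshPoints_of_profile_eq (hqF : q.dom ⊆ F)
    (h : profile (insert y F) w = profile (insert y F) w') (hw : w' ∈ freshPoints q r F y) :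
    w ∈ freshPoints q r F y := by
  have hF (x) (hx : x ∈ F) : dist w x = dist w' x :=
    dist_eq_of_profile_eq h (Finset.mem_insert_of_mem hx)
  refine ⟨fun x hx => (hF x (hqF hx)).trans (hw.1 x hx), fun x hx => ?_, ?_⟩
  · exact hF x hx ▸ hw.2.1 x hx
  · exact dist_eq_of_profile_eq h (Finset.mem_insert_self y F) ▸ hw.2.2

/-- An intermediate correction `e'` of `e`, unchanged on `F`, into a copy `H`. For the profiles
over `insert y F` in `T`, every correction of `e'` inside `H` that preserves the distances to `K`
sends the fresh points with this profile into `S`; the fresh points with any other profile still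
have images at distance at least `r` from `K`. -/
structure IsStage (D : Set ℝ) (r : ℝ) (S : Set M) (q : TypeFn M) (e : M → M) (F : Finset M)
    (y : M) (T : Finset (Profile (insert y F))) (H : Set M) (K : Finset M)
    (e' : M → M) : Prop where
  isCopy : IsCopy H
  subset_range : H ⊆ range e
  subset_copy : (K : Set M) ⊆ H
  isometry : Isometry e'
  map_mem : ∀ w, e' w ∈ H
  eqOn : EqOn e' e F
  map_mem_of_mem : ∀ x ∈ F, e' x ∈ K
  factorsThrough : ∀ k ∈ K, (fun w => dist (e' w) k).FactorsThrough (profile (insert y F))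
  below_le : ∀ w ∈ freshPoints q r F y, ∀ k ∈ K, below D r ≤ dist (e' w) k
  le_of_notMem : ∀ w ∈ freshPoints q r F y, profile (insert y F) w ∉ T →
    ∀ k ∈ K, r ≤ dist (e' w) k
  forced : ∀ w ∈ freshPoints q r F y, profile (insert y F) w ∈ T →
    ∀ u ∈ H, (∀ k ∈ K, dist u k = dist (e' w) k) → u ∈ S

lemma isStage_empty (D : Set ℝ) (hr : 0 ≤ r) (S : Set M) (q : TypeFn M) (he : Isometry e)
    (F : Finset M) (y : M) : IsStage D r S q e F y ∅ (range e) (F.image e) e := by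
  have hfresh (w) (hw : w ∈ freshPoints q r F y) : ∀ k ∈ F.image e, r ≤ dist (e w) k :=
    Finset.forall_mem_image.2 fun x hx => he.dist_eq w x ▸ hw.2.1 x hx
  have hbelow : below D r ≤ r := Real.sSup_le (fun a ha => ha.1.2.le) hr
  exact {
    isCopy := ⟨e, he, rfl⟩
    subset_range := subset_rfl
    subset_copy := by simp
    isometry := he
    map_mem := mem_range_self
    eqOn := fun _ _ => rfl
    map_mem_of_mem := fun _ hx => Finset.mem_image_of_mem e hx
    factorsThrough := Finset.forall_mem_image.2 fun x hx w w' h => by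
      simp only [he.dist_eq]
      exact dist_eq_of_profile_eq h (Finset.mem_insert_of_mem hx)
    below_le := fun w hw k hk => hbelow.trans (hfresh w hw k hk)
    le_of_notMem := fun w hw _ => hfresh w hw
    forced := by simp }

lemma IsStage.insert_of_forall_notMem {T : Finset (Profile (insert y F))}
    (hs : IsStage D r S q e F y T H K e') {t : Profile (insert y F)}
    (ht : ∀ w ∈ freshPoints q r F y, profile (insert y F) w ≠ t) :
    IsStage D r S q e F y (insert t T) H K e' :=
  { hs with
    le_of_notMem := fun w hw hwT => hs.le_of_notMem w hw (mt Finset.mem_insert_of_mem hwT)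
    forced := fun w hw hwT => hs.forced w hw (Finset.mem_of_mem_insert_of_ne hwT (ht w hw)) }

lemma IsStage.exists_subcopy {T : Finset (Profile (insert y F))} (hM : IsCountableUrysohn D M)
    (hext : ExtendibleInto D r S q) (hqF : q.dom ⊆ F) (heq : ∀ x ∈ q.dom, e x = x)
    (hs : IsStage D r S q e F y T H K e') (hv : v ∈ freshPoints q r F y)
    (hvT : profile (insert y F) v ∉ T) :
    ∃ H' g, IsCopy H' ∧ H' ⊆ H ∧ g.IsKatetov D ∧ g.HasRank (below D r) ∧
      (TypeFn.ofPoint K (e' v)).Sub g ∧ (g.dom : Set M) ⊆ H' ∧ H' ∩ g.realizations ⊆ S := by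
  have hfix (x) (hx : x ∈ q.dom) : e' x = x := (hs.eqOn (hqF hx)).trans (heq x hx)
  have hqK : q.dom ⊆ K := fun x hx => hfix x hx ▸ hs.map_mem_of_mem x (hqF hx)
  have hvq : e' v ∈ q.realizations := fun x hx => by
    rw [← hv.1 x hx, ← hs.isometry.dist_eq v x, hfix x hx]
  exact hext.exists_subcopy hM hs.isCopy hs.subset_copy hqK hvq (hs.le_of_notMem v hv hvT)

lemma IsStage.exists_insert {T : Finset (Profile (insert y F))} (hD : D.Finite)
    (hM : IsCountableUrysohn D M) (hgap : ∀ a ∈ D, 0 < a → r ≤ below D r + a)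
    (hext : ExtendibleInto D r S q) (hqF : q.dom ⊆ F) (heq : ∀ x ∈ q.dom, e x = x)
    (hs : IsStage D r S q e F y T H K e') (hv : v ∈ freshPoints q r F y)
    (hvT : profile (insert y F) v ∉ T) :
    ∃ H' K' e'', IsStage D r S q e F y (insert (profile (insert y F) v) T) H' K' e'' := by
  have : Nonempty M := ⟨v⟩
  obtain ⟨H', g, hH', hH'H, hg, hgrank, hsub, hgH', hgS⟩ :=
    hs.exists_subcopy hM hext hqF heq hv hvT
  have hbelow (k) (hk : k ∈ g.dom) : below D r ≤ g.val k := hgrank.2 ⟨k, hk, rfl⟩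
  have hfresh {w} (h : profile (insert y F) w = profile (insert y F) v) :
      w ∈ freshPoints q r F y := mem_freshPoints_of_profile_eq hqF h hv
  obtain ⟨e'', he'', he''H, hK, hv', hcongr, hle⟩ := exists_isometry_realizing hD hM hH' hg hgH'
    hs.isometry hsub hs.factorsThrough fun w w' hw hw' k hk =>
      (dist_le_of_mem_freshPoints hD hM (hfresh hw) (hfresh hw')).trans
        (add_le_add (hbelow k hk) (hbelow k hk))
  have heF : EqOn e'' e' F := fun x hx => by
    rw [← dist_eq_zero, hK _ _ (hs.map_mem_of_mem x hx), dist_self]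
  refine ⟨H', g.dom, e'', {
    isCopy := hH'
    subset_range := hH'H.trans hs.subset_range
    subset_copy := hgH'
    isometry := he''
    map_mem := he''H
    eqOn := heF.trans hs.eqOn
    map_mem_of_mem := fun x hx => heF hx ▸ hsub.1 (hs.map_mem_of_mem x hx)
    factorsThrough := hcongr
    below_le := fun w hw k hk => ?_
    le_of_notMem := fun w hw hwT k hk => ?_
    forced := fun w hw hwT u hu huk => ?_ }⟩
  · exact hle _ (hg.rank_mem hgrank) w k hk
      (fun w' _ => le_add_of_nonneg_of_le dist_nonneg (hbelow k hk)) (hs.below_le w hw)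
  · refine hle r (hext.1.rank_mem hext.2.1) w k hk (fun w' hw' => ?_)
      (hs.le_of_notMem w hw (mt Finset.mem_insert_of_mem hwT))
    have hne : w ≠ w' := by
      rintro rfl
      exact hwT (hw' ▸ Finset.mem_insert_self _ _)
    linarith [hgap _ (hM.dist_mem w w') (dist_pos.2 hne), hbelow k hk]
  · rcases Finset.mem_insert.1 hwT with hwv | hwT
    · exact hgS ⟨hu, fun k hk => (huk k hk).trans (hv' w hwv k hk)⟩
    · exact hs.forced w hw hwT u (hH'H hu) fun k hk => (huk k (hsub.1 hk)).trans (hK w k hk)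

lemma exists_isStage (hD : D.Finite) (hM : IsCountableUrysohn D M)
    (hgap : ∀ a ∈ D, 0 < a → r ≤ below D r + a) (hext : ExtendibleInto D r S q)
    (hqF : q.dom ⊆ F) (he : Isometry e) (heq : ∀ x ∈ q.dom, e x = x) (y : M)
    (T : Finset (Profile (insert y F))) : ∃ H K e', IsStage D r S q e F y T H K e' := by
  classical
  induction T using Finset.induction_on with
  | empty => exact ⟨_, _, _, isStage_empty D (hext.1.rank_pos hext.2.1).le S q he F y⟩
  | insert t T htT ih =>
    obtain ⟨H, K, e', hs⟩ := ih
    by_cases ht : ∃ v ∈ freshPoints q r F y, profile (insert y F) v = t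
    · obtain ⟨v, hv, rfl⟩ := ht
      exact hs.exists_insert hD hM hgap hext hqF heq hv htT
    · exact ⟨H, K, e', hs.insert_of_forall_notMem fun w hw hwt => ht ⟨w, hw, hwt⟩⟩

lemma exists_isometry_insert (hD : D.Finite) (hM : IsCountableUrysohn D M)
    (hgap : ∀ a ∈ D, 0 < a → r ≤ below D r + a) (hext : ExtendibleInto D r S q)
    (hqF : q.dom ⊆ F) (he : Isometry e) (heq : ∀ x ∈ q.dom, e x = x)
    (heS : ∀ w ∈ q.realizations, ∀ x ∈ F, dist w x < r → e w ∈ S) (y : M) :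
    ∃ e' : M → M, Isometry e' ∧ EqOn e' e F ∧
      ∀ w ∈ q.realizations, ∀ x ∈ insert y F, dist w x < r → e' w ∈ S := by
  obtain ⟨H, K, e', hs⟩ := exists_isStage hD hM hgap hext hqF he heq y
    (finite_range_profile hD hM (insert y F)).toFinset
  refine ⟨e', hs.isometry, hs.eqOn, fun w hw x hx hwx => ?_⟩
  by_cases hwF : ∀ x ∈ F, r ≤ dist w x
  · have hxy : x = y := (Finset.mem_insert.1 hx).resolve_right fun hxF => (hwF x hxF).not_gt hwx
    exact hs.forced w ⟨hw, hwF, hxy ▸ hwx⟩ (by simp) _ (hs.map_mem w) fun _ _ => rfl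
  · push Not at hwF
    obtain ⟨x', hx', hwx'⟩ := hwF
    obtain ⟨w', hw'⟩ := hs.subset_range (hs.map_mem w)
    have hdist (z) (hz : z ∈ F) : dist w' z = dist w z := by
      rw [← he.dist_eq, hw', ← hs.eqOn hz, hs.isometry.dist_eq]
    rw [← hw']
    exact heS w' (fun z hz => (hdist z (hqF hz)).trans (hw z hz)) x' hx'
      ((hdist x' hx').trans_lt hwx')

end Stage

lemma exists_isometry_mapsTo_realizations (hD : D.Finite) (hM : IsCountableUrysohn D M)
    (hgap : ∀ a ∈ D, 0 < a → r ≤ below D r + a) (hext : ExtendibleInto D r S q) :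
    ∃ e : M → M, Isometry e ∧ (∀ x ∈ q.dom, e x = x) ∧ MapsTo e q.realizations S := by
  classical
  have := hM.countable
  obtain ⟨hq, hrank, -⟩ := id hext
  let P (F : Finset M) (e : M → M) : Prop := q.dom ⊆ F ∧ Isometry e ∧ (∀ x ∈ q.dom, e x = x) ∧
    ∀ w ∈ q.realizations, ∀ x ∈ F, dist w x < r → e w ∈ S
  have h₀ : P q.dom id := ⟨subset_rfl, isometry_id, fun _ _ => rfl, fun w hw x hx hwx =>
    absurd hwx (hw x hx ▸ (hrank.2 ⟨x, hx, rfl⟩).not_gt)⟩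
  obtain ⟨e, he⟩ := exists_fusion P h₀ fun F e y ⟨hqF, he, heq, heS⟩ => by
    obtain ⟨e', he', hee', he'S⟩ := exists_isometry_insert hD hM hgap hext hqF he heq heS y
    exact ⟨e', ⟨hqF.trans (Finset.subset_insert y F), he',
      fun x hx => (hee' (hqF hx)).trans (heq x hx), he'S⟩, hee'⟩
  refine ⟨e, Isometry.of_dist_eq fun x y => ?_, fun x hx => ?_, fun w hw => ?_⟩
  · obtain ⟨F, f, hxy, ⟨-, hf, -⟩, hef⟩ := he {x, y}
    rw [hef (hxy (by simp)), hef (hxy (by simp)), hf.dist_eq]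
  · obtain ⟨F, f, -, ⟨hqF, -, hf, -⟩, hef⟩ := he ∅
    rw [hef (hqF hx), hf x hx]
  · obtain ⟨F, f, hwF, ⟨-, -, -, hf⟩, hef⟩ := he {w}
    have hwF : w ∈ F := hwF (by simp)
    rw [hef hwF]
    exact hf w hw w hwF ((dist_self w).trans_lt (hq.rank_pos hrank))

end Construction
end UrysohnExt

open UrysohnExt in
theorem theorem7p1_general {M : Type*} [MetricSpace M] {D : Set ℝ} (hD : D.Finite)
    (hM : IsCountableUrysohn D M) {r : ℝ} (hgap : ∀ a ∈ D, 0 < a → r ≤ below D r + a)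
    {S : Set M} {q : TypeFn M} (hext : ExtendibleInto D r S q) :
    ∃ C : Set M, IsCopy C ∧ (q.dom : Set M) ⊆ C ∧ q.orb C ⊆ S := by
  obtain ⟨e, he, hfix, heS⟩ := exists_isometry_mapsTo_realizations hD hM hgap hext
  refine ⟨Set.range e, ⟨e, he, rfl⟩, fun x hx => ⟨x, hfix x hx⟩, ?_⟩
  rw [hext.1.orb_eq]
  rintro _ ⟨⟨w, rfl⟩, hw⟩
  refine heS fun x hx => ?_
  rw [← hw x hx, ← he.dist_eq, hfix x hx]

theorem theorem7p1 {M : Type*} [MetricSpace M] (D B : Set ℝ) (hD : D.Finite)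
    (hM : UrysohnExt.IsCountableUrysohn D M) (hB : UrysohnExt.IsFirstBlock D B)
    (m r : ℝ) (hm : IsLeast B m) (hr : r ∈ B) (hmr : m < r)
    (S : Set M) (q : UrysohnExt.TypeFn M)
    (hq : q.IsKatetov D) (hrank : q.HasRank r)
    (hext : UrysohnExt.ExtendibleInto D r S q) :
    ∃ C : Set M, UrysohnExt.IsCopy C ∧ (q.dom : Set M) ⊆ C ∧ q.orb C ⊆ S :=
  theorem7p1_general hD hM (fun _ => hB.le_below_add hD hm hr hmr) hext
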